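/- There are universal constants $C,c>0$ such that the following holds for all integers $n,r\ge 0$ and all reals $\beta>1$ and $p\le 1$ with $p>C\,\frac{\beta\log n}{n}$ (with the convention that the right-hand side is $0$ for $n=0$). Let $(\delta_{(i,j)})_{1\le i<j\le n}$ be i.i.d. Bernoulli random variables with $\mathbb P(\delta_{(i,j)}=1)=p$ and $\mathbb P(\delta_{(i,j)}=0)=1-p$. For symmetric $G\in\mathbb R^{n\times n}$ let $$g(G)=\mathrm{diag}(G)\mathbf 1^T+\mathbf 1\,\mathrm{diag}(G)^T-2G,$$ where $\mathrm{diag}(G)$ is the column vector of the diagonal entries of $G$ and $\mathbf 1$ is the all-ones vector. For $D\in\mathbb R^{n\times n}$ let $$\mathcal P_\Omega(D)=\sum_{1\le i<j\le n}\delta_{(i,j)}\left(D_{ij}\,e_ie_j^T+D_{ji}\,e_je_i^T\right),$$ and put $\mathcal Q_\Omega(G)=\mathcal P_\Omega(g(G))$. Then, with probability at least $1-n^{1-\beta}$, the inequality $$\frac1p\left\|\mathcal Q_\Omega(\Delta\Delta^T)\right\|_F^2\le\left[\left(8n+\sqrt{\frac{c\,\beta\, n\log n}{p}}\right)\|\Delta\|_{2,\infty}^2+8\|\Delta\|_F^2\right]\|\Delta\|_F^2$$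 holds simultaneously for all $\Delta\in\mathbb R^{n\times r}$. Here $\|\cdot\|_F$ is the Frobenius norm and $\|\Delta\|_{2,\infty}$ is the largest Euclidean norm of a row of $\Delta$. -/

import Mathlib

open MeasureTheory ProbabilityTheory
open scoped Matrix Matrix.Norms.Frobenius

/-- The index set `{(i, j) : i < j}` of unordered pairs of points. -/
abbrev PairIndex (n : ℕ) : Type := {α : Fin n × Fin n // α.1 < α.2}

/-- The map `g(G) = diag(G) 1ᵀ + 1 diag(G)ᵀ - 2 G` from Gram matrices to squared distance
matrices. -/
def gramToEDM {n : ℕ} (G : Matrix (Fin n) (Fin n) ℝ) : Matrix (Fin n) (Fin n) ℝ :=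
  Matrix.vecMulVec G.diag 1 + Matrix.vecMulVec 1 G.diag - (2 : ℝ) • G

/-- The symmetric sample operator
`P(D) = ∑_{α = (i, j), i < j} d_α (⟨D, eᵢ eⱼᵀ⟩ eᵢ eⱼᵀ + ⟨D, eⱼ eᵢᵀ⟩ eⱼ eᵢᵀ)`,
where `⟨D, eᵢ eⱼᵀ⟩ = D i j` and `d_α ∈ {0, 1}` tells whether the pair `α` is sampled. -/
def sampleOp {n : ℕ} (d : PairIndex n → ℝ) (D : Matrix (Fin n) (Fin n) ℝ) :
    Matrix (Fin n) (Fin n) ℝ :=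
  ∑ α : PairIndex n, d α •
    (D α.1.1 α.1.2 • Matrix.single α.1.1 α.1.2 (1 : ℝ) +
      D α.1.2 α.1.1 • Matrix.single α.1.2 α.1.1 (1 : ℝ))

/-- The sensing operator `Q = P ∘ g`. -/
def sensingOp {n : ℕ} (d : PairIndex n → ℝ) (G : Matrix (Fin n) (Fin n) ℝ) :
    Matrix (Fin n) (Fin n) ℝ :=
  sampleOp d (gramToEDM G)

/-- The row-wise norm `‖A‖_{2,∞}`: the largest Euclidean norm of a row. -/
noncomputable def twoInftyNorm {n r : ℕ} (A : Matrix (Fin n) (Fin r) ℝ) : ℝ :=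
  ⨆ i : Fin n, ‖WithLp.toLp 2 (A i)‖

/-- `(δ_α)_{α = (i, j), i < j}` are i.i.d. Bernoulli random variables with values `0`, `1` and
success probability `p`. -/
structure IsBernoulliSampling {n : ℕ} {Ω : Type*} [MeasurableSpace Ω] (μ : Measure Ω) (p : ℝ)
    (δ : PairIndex n → Ω → ℝ) : Prop where
  measurable : ∀ α, Measurable (δ α)
  indep : iIndepFun δ μ
  zero_or_one : ∀ α, ∀ᵐ x ∂μ, δ α x = 0 ∨ δ α x = 1
  prob_one : ∀ α, μ.real {x | δ α x = 1} = p

/-! Let `a i` be the squared norm of the `i`-th row of `Δ`, and `M` the square of its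
`twoInftyNorm`. The entries of `gramToEDM (Δ * Δᵀ)` are squared distances between rows, so the left
side is at most a multiple of `∑ d_α (a i + a j) ^ 2`. Here `a i ^ 2 + a j ^ 2 ≤ M (a i + a j)`
reduces the squares to vertex degrees of the random graph. In the cross terms, the mean `p` gives
the `‖Δ‖ ^ 4` term, and the fluctuation `d_α - p` gives a quadratic form without diagonal. That form
is affine in each variable, so on a cube it is controlled by the vertices, that is, by edge counts
within sets `S`.

Only these combinatorial counts are random, so one event serves every `Δ` at once. Allowing a
deviation `K |S|` makes the Chernoff failure probability `q ^ |S|`, small enough to sum over all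
nonempty `S`: the total is `(1 + q) ^ n - 1`. -/

/-! ### Reduction to squared row norms -/

/-- A sum over all ordered pairs splits into the off-diagonal pairs and the diagonal. -/
lemma sum_sum_eq_sum_pairIndex_add_diag {n : ℕ} (h : Fin n → Fin n → ℝ) :
    ∑ i, ∑ j, h i j =
      ∑ α : PairIndex n, (h α.1.1 α.1.2 + h α.1.2 α.1.1) + ∑ i, h i i := by
  have key : ∀ f : Fin n → Fin n → ℝ,
      ∑ α : PairIndex n, f α.1.1 α.1.2 = ∑ i, ∑ j, if i < j then f i j else 0 := by
    intro f
    rw [← Fintype.sum_prod_type' (fun i j => if i < j then f i j else 0), ← Finset.sum_filter]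
    exact (Finset.sum_subtype (Finset.univ.filter fun x : Fin n × Fin n => x.1 < x.2)
      (by simp) fun x => f x.1 x.2).symm
  rw [Finset.sum_add_distrib, key h, key fun i j => h j i,
    Finset.sum_comm (f := fun i j => if i < j then h j i else 0), ← Finset.sum_add_distrib,
    ← Finset.sum_add_distrib]
  refine Finset.sum_congr rfl fun i _ => ?_
  have hd : h i i = ∑ j, if j = i then h i j else 0 := by simp
  rw [hd, ← Finset.sum_add_distrib, ← Finset.sum_add_distrib]
  refine Finset.sum_congr rfl fun j _ => ?_
  rcases lt_trichotomy i j with hij | rfl | hij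
  · simp [hij, hij.not_gt, hij.ne']
  · simp
  · simp [hij, hij.not_gt, hij.ne]

lemma sampleOp_apply_lt {n : ℕ} (d : PairIndex n → ℝ) (D : Matrix (Fin n) (Fin n) ℝ)
    (α : PairIndex n) : sampleOp d D α.1.1 α.1.2 = d α * D α.1.1 α.1.2 := by
  obtain ⟨⟨i, j⟩, hij⟩ := α
  simp only [sampleOp, Matrix.sum_apply]
  rw [Finset.sum_eq_single ⟨(i, j), hij⟩]
  · have : j ≠ i := (ne_of_lt hij).symm
    simp [this]
  · rintro ⟨⟨k, l⟩, hkl⟩ _ hne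
    have h1 : ¬ (k = i ∧ l = j) := fun h => hne (by simp [h.1, h.2])
    have h2 : ¬ (l = i ∧ k = j) := fun h => by
      simp only at hij hkl; rw [h.1, h.2] at hkl; exact absurd hij hkl.not_gt
    simp [h1, h2]
  · simp

lemma sampleOp_apply_gt {n : ℕ} (d : PairIndex n → ℝ) (D : Matrix (Fin n) (Fin n) ℝ)
    (α : PairIndex n) : sampleOp d D α.1.2 α.1.1 = d α * D α.1.2 α.1.1 := by
  obtain ⟨⟨i, j⟩, hij⟩ := α
  simp only [sampleOp, Matrix.sum_apply]
  rw [Finset.sum_eq_single ⟨(i, j), hij⟩]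
  · have : i ≠ j := ne_of_lt hij
    simp [this]
  · rintro ⟨⟨k, l⟩, hkl⟩ _ hne
    have h1 : ¬ (l = j ∧ k = i) := fun h => hne (by simp [h.1, h.2])
    have h2 : ¬ (k = j ∧ l = i) := fun h => by
      simp only at hij hkl; rw [h.1, h.2] at hkl; exact absurd hij hkl.not_gt
    simp [h1, h2]
  · simp

lemma sampleOp_apply_self {n : ℕ} (d : PairIndex n → ℝ) (D : Matrix (Fin n) (Fin n) ℝ)
    (i : Fin n) : sampleOp d D i i = 0 := by
  simp only [sampleOp, Matrix.sum_apply]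
  refine Finset.sum_eq_zero ?_
  rintro ⟨⟨k, l⟩, hkl⟩ _
  have h1 : ¬ (k = i ∧ l = i) := fun h => hkl.ne (h.1.trans h.2.symm)
  have h2 : ¬ (l = i ∧ k = i) := fun h => h1 h.symm
  simp [h1, h2]

lemma frobenius_norm_sq {m n : ℕ} (A : Matrix (Fin m) (Fin n) ℝ) :
    ‖A‖ ^ 2 = ∑ i, ∑ j, A i j ^ 2 := by
  rw [Matrix.frobenius_norm_def, ← Real.sqrt_eq_rpow, Real.sq_sqrt (by positivity)]
  simp

lemma norm_sampleOp_sq {n : ℕ} (d : PairIndex n → ℝ) (D : Matrix (Fin n) (Fin n) ℝ) :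
    ‖sampleOp d D‖ ^ 2 = ∑ α, d α ^ 2 * (D α.1.1 α.1.2 ^ 2 + D α.1.2 α.1.1 ^ 2) := by
  rw [frobenius_norm_sq, sum_sum_eq_sum_pairIndex_add_diag]
  simp only [sampleOp_apply_lt, sampleOp_apply_gt, sampleOp_apply_self]
  simp [mul_pow, mul_add]

lemma gramToEDM_mul_transpose {n r : ℕ} (Δ : Matrix (Fin n) (Fin r) ℝ) (i j : Fin n) :
    gramToEDM (Δ * Δᵀ) i j = ∑ k, (Δ i k - Δ j k) ^ 2 := by
  simp only [gramToEDM, Matrix.sub_apply, Matrix.add_apply, Matrix.vecMulVec_apply,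
    Matrix.diag_apply, Matrix.smul_apply, Matrix.mul_apply, Matrix.transpose_apply, Pi.one_apply,
    smul_eq_mul, mul_one, one_mul, Finset.mul_sum]
  rw [← Finset.sum_add_distrib, ← Finset.sum_sub_distrib]
  exact Finset.sum_congr rfl fun k _ => by ring

lemma gramToEDM_mul_transpose_le {n r : ℕ} (Δ : Matrix (Fin n) (Fin r) ℝ) (i j : Fin n) :
    gramToEDM (Δ * Δᵀ) i j ≤ 2 * (∑ k, Δ i k ^ 2 + ∑ k, Δ j k ^ 2) := by
  rw [gramToEDM_mul_transpose, ← Finset.sum_add_distrib, Finset.mul_sum]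
  exact Finset.sum_le_sum fun k _ => by nlinarith [sq_nonneg (Δ i k + Δ j k)]

/-- Squaring the bound on a squared distance gives the factor 4, and each pair occupies two matrix
entries. -/
lemma norm_sensingOp_sq_le {n r : ℕ} (d : PairIndex n → ℝ) (hd : ∀ α, d α = 0 ∨ d α = 1)
    (Δ : Matrix (Fin n) (Fin r) ℝ) :
    ‖sensingOp d (Δ * Δᵀ)‖ ^ 2 ≤
      8 * ∑ α : PairIndex n, d α * (∑ k, Δ α.1.1 k ^ 2 + ∑ k, Δ α.1.2 k ^ 2) ^ 2 := by
  rw [sensingOp, norm_sampleOp_sq, Finset.mul_sum]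
  refine Finset.sum_le_sum fun α _ => ?_
  have hle : ∀ i j, gramToEDM (Δ * Δᵀ) i j ^ 2 ≤
      4 * (∑ k, Δ i k ^ 2 + ∑ k, Δ j k ^ 2) ^ 2 := fun i j => by
    calc _ ≤ (2 * (∑ k, Δ i k ^ 2 + ∑ k, Δ j k ^ 2)) ^ 2 :=
          pow_le_pow_left₀ (by rw [gramToEDM_mul_transpose]; positivity)
            (gramToEDM_mul_transpose_le Δ i j) 2
      _ = _ := by ring
  have h1 := hle α.1.1 α.1.2
  have h2 := hle α.1.2 α.1.1
  rcases hd α with h | h <;> rw [h] <;> nlinarith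

lemma sum_sq_row_le_twoInftyNorm_sq {n r : ℕ} (Δ : Matrix (Fin n) (Fin r) ℝ) (i : Fin n) :
    ∑ k, Δ i k ^ 2 ≤ twoInftyNorm Δ ^ 2 := by
  have h : ‖WithLp.toLp 2 (Δ i)‖ ≤ twoInftyNorm Δ :=
    le_ciSup (f := fun i : Fin n => ‖WithLp.toLp 2 (Δ i)‖) (Set.finite_range _).bddAbove i
  calc ∑ k, Δ i k ^ 2 = ‖WithLp.toLp 2 (Δ i)‖ ^ 2 := by
        rw [EuclideanSpace.norm_sq_eq]; simp
    _ ≤ _ := pow_le_pow_left₀ (norm_nonneg _) h 2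

/-! ### Degrees, edge counts and the deterministic estimate -/

/-- The pairs that contain the point `i`. -/
abbrev incidentPairs {n : ℕ} (i : Fin n) : Finset (PairIndex n) :=
  Finset.univ.filter fun α => i = α.1.1 ∨ i = α.1.2

/-- The pairs of points of `S`. -/
abbrev pairsWithin {n : ℕ} (S : Finset (Fin n)) : Finset (PairIndex n) :=
  Finset.univ.filter fun α => α.1.1 ∈ S ∧ α.1.2 ∈ S

lemma card_incidentPairs_le {n : ℕ} (i : Fin n) : (incidentPairs i).card ≤ n := by
  calc _ ≤ (Finset.univ : Finset (Fin n)).card := by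
        -- A pair containing `i` is determined by its other point.
        refine Finset.card_le_card_of_injOn
          (fun α => if i = α.1.1 then α.1.2 else α.1.1) (by simp) ?_
        rintro ⟨⟨a, b⟩, hab⟩ h1 ⟨⟨c, d⟩, hcd⟩ h2 h
        simp only [Finset.coe_filter, Finset.mem_univ, true_and, Set.mem_ofPred_eq] at h1 h2 h hab hcd
        have : a = c ∧ b = d := by grind
        simp [this.1, this.2]
    _ = n := by simp

lemma card_pairsWithin_le {n : ℕ} (S : Finset (Fin n)) :
    (pairsWithin S).card ≤ S.card * n := by
  calc _ ≤ (S ×ˢ (Finset.univ : Finset (Fin n))).card :=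
        Finset.card_le_card_of_injOn Subtype.val
          (fun α hα => by simpa using (Finset.mem_filter.1 hα).2.1) Subtype.val_injective.injOn
    _ = _ := by simp

lemma sum_pairIndex_mul_add_eq {n : ℕ} (d : PairIndex n → ℝ) (a : Fin n → ℝ) :
    ∑ α : PairIndex n, d α * (a α.1.1 + a α.1.2) = ∑ i, a i * ∑ α ∈ incidentPairs i, d α := by
  simp only [Finset.mul_sum, Finset.sum_filter]
  rw [Finset.sum_comm]
  refine Finset.sum_congr rfl fun α _ => ?_
  have : ∀ i, a i * (if i = α.1.1 ∨ i = α.1.2 then d α else 0) =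
      (if i = α.1.1 then a i * d α else 0) + if i = α.1.2 then a i * d α else 0 := by
    intro i
    have := α.2.ne
    grind
  rw [Finset.sum_congr rfl fun i _ => this i, Finset.sum_add_distrib]
  simp only [Finset.sum_ite_eq', Finset.mem_univ, if_true]
  ring

/-- A quadratic form without diagonal is affine in each variable, so that on the cube it is
controlled by its values at the vertices. -/
lemma sum_pairIndex_mul_le_of_vertices {n : ℕ} (w : PairIndex n → ℝ) (b : ℝ)
    (h : ∀ S : Finset (Fin n), ∑ α ∈ pairsWithin S, w α ≤ b * S.card)
    (a : Fin n → ℝ) (h0 : ∀ i, 0 ≤ a i) (h1 : ∀ i, a i ≤ 1) :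
    ∑ α : PairIndex n, w α * (a α.1.1 * a α.1.2) ≤ b * ∑ i, a i := by
  -- Induction on a set `T` of coordinates outside which `a` is already 0 or 1.
  suffices H : ∀ (T : Finset (Fin n)) (a : Fin n → ℝ), (∀ i, 0 ≤ a i) → (∀ i, a i ≤ 1) →
      (∀ i ∉ T, a i = 0 ∨ a i = 1) →
      ∑ α : PairIndex n, w α * (a α.1.1 * a α.1.2) ≤ b * ∑ i, a i from
    H Finset.univ a h0 h1 (by simp)
  intro T
  induction T using Finset.induction_on with
  | empty =>
    intro a _ _ ha
    have hi : ∀ i, a i = if i ∈ Finset.univ.filter (fun i => a i = 1) then 1 else 0 := by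
      intro i
      rcases ha i (by simp) with h | h <;> simp [h]
    have := h (Finset.univ.filter fun i => a i = 1)
    convert this using 1
    · rw [Finset.sum_filter]
      refine Finset.sum_congr rfl fun α _ => ?_
      have e : ∀ i, a i = 0 ∨ a i = 1 := fun i => ha i (by simp)
      rcases e α.1.1 with h1 | h1 <;> rcases e α.1.2 with h2 | h2 <;> simp [h1, h2]
    · rw [Finset.sum_congr rfl fun i _ => hi i]
      simp
  | insert k T _ ih =>
    intro a ha0 ha1 ha
    have hx : ∀ x : ℝ, 0 ≤ x → x ≤ 1 → (x = 0 ∨ x = 1) →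
        ∑ α : PairIndex n, w α *
          (Function.update a k x α.1.1 * Function.update a k x α.1.2) ≤
            b * ∑ i, Function.update a k x i := by
      intro x hx0 hx1 hx
      refine ih _ (fun i => ?_) (fun i => ?_) (fun i hi => ?_) <;>
        rcases eq_or_ne i k with rfl | hik <;> simp_all
    have e0 := hx 0 le_rfl zero_le_one (.inl rfl)
    have e1 := hx 1 zero_le_one le_rfl (.inr rfl)
    -- Since `i ≠ j` in every pair, each product is affine in `a k`: both sides interpolate between
    -- their values at `a k = 0` and `a k = 1`.
    have q : ∑ α : PairIndex n, w α * (a α.1.1 * a α.1.2) =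
        (1 - a k) * ∑ α : PairIndex n, w α *
          (Function.update a k 0 α.1.1 * Function.update a k 0 α.1.2) +
        a k * ∑ α : PairIndex n, w α *
          (Function.update a k 1 α.1.1 * Function.update a k 1 α.1.2) := by
      simp only [Finset.mul_sum]
      rw [← Finset.sum_add_distrib]
      refine Finset.sum_congr rfl fun α _ => ?_
      have := α.2.ne
      simp only [Function.update_apply]
      split_ifs with h1 h2 h2
      · exact absurd (h1.trans h2.symm) this
      · rw [h1]; ring
      · rw [h2]; ring
      · ring
    have l : ∑ i, a i = (1 - a k) * ∑ i, Function.update a k 0 i +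
        a k * ∑ i, Function.update a k 1 i := by
      simp only [Finset.mul_sum]
      rw [← Finset.sum_add_distrib]
      refine Finset.sum_congr rfl fun i _ => ?_
      simp only [Function.update_apply]
      split_ifs with h1
      · rw [h1]; ring
      · ring
    rw [q, l]
    nlinarith [mul_le_mul_of_nonneg_left e0 (sub_nonneg.2 (ha1 k)),
      mul_le_mul_of_nonneg_left e1 (ha0 k)]

/-- Rescaling the unit cube: the left side has degree 2 in `a` and the right side degree 1, which
leaves one factor `M`. -/
lemma sum_pairIndex_mul_le {n : ℕ} (w : PairIndex n → ℝ) (b M : ℝ)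
    (h : ∀ S : Finset (Fin n), ∑ α ∈ pairsWithin S, w α ≤ b * S.card)
    (a : Fin n → ℝ) (h0 : ∀ i, 0 ≤ a i) (hM : ∀ i, a i ≤ M) (hM0 : 0 ≤ M) :
    ∑ α : PairIndex n, w α * (a α.1.1 * a α.1.2) ≤ b * M * ∑ i, a i := by
  rcases hM0.eq_or_lt with rfl | hpos
  · have : ∀ i, a i = 0 := fun i => le_antisymm (hM i) (h0 i)
    simp [this]
  · have := sum_pairIndex_mul_le_of_vertices w b h (fun i => a i / M)
      (fun i => div_nonneg (h0 i) hM0) (fun i => (div_le_one hpos).2 (hM i))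
    have e1 : ∑ α : PairIndex n, w α * (a α.1.1 * a α.1.2) =
        M ^ 2 * ∑ α : PairIndex n, w α * (a α.1.1 / M * (a α.1.2 / M)) := by
      rw [Finset.mul_sum]
      exact Finset.sum_congr rfl fun α _ => by field_simp
    have e2 : b * M * ∑ i, a i = M ^ 2 * (b * ∑ i, a i / M) := by
      rw [← Finset.sum_div]; field_simp
    rw [e1, e2]
    exact mul_le_mul_of_nonneg_left this (by positivity)

/-- The deterministic part of the estimate: it follows from upper bounds on the degrees and on the
number of edges within each set of points. -/
lemma norm_sensingOp_sq_le_of_regular {n r : ℕ} (d : PairIndex n → ℝ)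
    (hd : ∀ α, d α = 0 ∨ d α = 1) {p K : ℝ} (hp : 0 < p)
    (hdeg : ∀ i, ∑ α ∈ incidentPairs i, d α ≤ n * p + K)
    (hset : ∀ S : Finset (Fin n),
      ∑ α ∈ pairsWithin S, d α ≤ p * (pairsWithin S).card + K * S.card)
    (Δ : Matrix (Fin n) (Fin r) ℝ) :
    1 / p * ‖sensingOp d (Δ * Δᵀ)‖ ^ 2 ≤
      ((8 * n + 24 * K / p) * twoInftyNorm Δ ^ 2 + 8 * ‖Δ‖ ^ 2) * ‖Δ‖ ^ 2 := by
  set a : Fin n → ℝ := fun i => ∑ k, Δ i k ^ 2 with ha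
  set M := twoInftyNorm Δ ^ 2 with hMdef
  have ha0 : ∀ i, 0 ≤ a i := fun i => Finset.sum_nonneg fun _ _ => sq_nonneg _
  have haM : ∀ i, a i ≤ M := fun i => sum_sq_row_le_twoInftyNorm_sq Δ i
  have hM0 : 0 ≤ M := sq_nonneg _
  have hF : ‖Δ‖ ^ 2 = ∑ i, a i := frobenius_norm_sq Δ
  have hF0 : 0 ≤ ∑ i, a i := Finset.sum_nonneg fun i _ => ha0 i
  have hd0 : ∀ α, 0 ≤ d α := fun α => by rcases hd α with h | h <;> simp [h]
  have key := norm_sensingOp_sq_le d hd Δ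
  have hlin : ∑ α : PairIndex n, d α * (a α.1.1 + a α.1.2) ≤ (n * p + K) * ∑ i, a i := by
    rw [sum_pairIndex_mul_add_eq, Finset.mul_sum]
    exact Finset.sum_le_sum fun i _ => by nlinarith [hdeg i, ha0 i]
  have hquad : ∑ α : PairIndex n, (d α - p) * (a α.1.1 * a α.1.2) ≤ K * M * ∑ i, a i := by
    refine sum_pairIndex_mul_le _ K M (fun S => ?_) a ha0 haM hM0
    rw [Finset.sum_sub_distrib, Finset.sum_const, nsmul_eq_mul]
    linarith [hset S]
  have hall : 2 * ∑ α : PairIndex n, a α.1.1 * a α.1.2 ≤ (∑ i, a i) ^ 2 := by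
    rw [sq, Finset.sum_mul_sum, sum_sum_eq_sum_pairIndex_add_diag fun i j => a i * a j,
      Finset.mul_sum]
    have : 0 ≤ ∑ i, a i * a i := Finset.sum_nonneg fun i _ => mul_self_nonneg _
    refine le_add_of_le_of_nonneg (Finset.sum_le_sum fun α _ => ?_) this
    linarith [mul_comm (a α.1.1) (a α.1.2)]
  have hsplit : ∑ α : PairIndex n, d α * (a α.1.1 + a α.1.2) ^ 2 ≤
      M * ∑ α : PairIndex n, d α * (a α.1.1 + a α.1.2) +
      2 * ∑ α : PairIndex n, (d α - p) * (a α.1.1 * a α.1.2) +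
      p * (2 * ∑ α : PairIndex n, a α.1.1 * a α.1.2) := by
    simp only [Finset.mul_sum]
    rw [← Finset.sum_add_distrib, ← Finset.sum_add_distrib]
    refine Finset.sum_le_sum fun α _ => ?_
    have : a α.1.1 ^ 2 + a α.1.2 ^ 2 ≤ M * (a α.1.1 + a α.1.2) := by
      nlinarith [ha0 α.1.1, ha0 α.1.2, haM α.1.1, haM α.1.2]
    nlinarith [mul_le_mul_of_nonneg_left this (hd0 α)]
  rw [hF]
  have htot : ‖sensingOp d (Δ * Δᵀ)‖ ^ 2 ≤
      8 * (M * ((n * p + K) * ∑ i, a i) + 2 * (K * M * ∑ i, a i) + p * (∑ i, a i) ^ 2) := by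
    refine key.trans (mul_le_mul_of_nonneg_left (hsplit.trans ?_) (by norm_num))
    gcongr
  calc 1 / p * ‖sensingOp d (Δ * Δᵀ)‖ ^ 2 ≤ 1 / p * _ :=
        mul_le_mul_of_nonneg_left htot (by positivity)
    -- The degrees contribute `K` and the cross terms `2 K`, hence `24 = 8 * (1 + 2)`.
    _ = _ := by field_simp; ring

/-! ### Chernoff bounds and the union bound -/

section BernoulliSampling

variable {n : ℕ} {Ω : Type*} [MeasurableSpace Ω] {μ : Measure Ω} {p : ℝ}
  {δ : PairIndex n → Ω → ℝ}

lemma IsBernoulliSampling.exp_mul_ae_eq (hδ : IsBernoulliSampling μ p δ) (α : PairIndex n)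
    (t : ℝ) : (fun x => Real.exp (t * δ α x)) =ᵐ[μ]
      fun x => 1 + (Real.exp t - 1) * {x | δ α x = 1}.indicator (fun _ => (1 : ℝ)) x := by
  filter_upwards [hδ.zero_or_one α] with x hx
  rcases hx with h | h <;> simp [Set.indicator, h]

lemma IsBernoulliSampling.measurableSet (hδ : IsBernoulliSampling μ p δ) (α : PairIndex n) :
    MeasurableSet {x | δ α x = 1} :=
  hδ.measurable α (measurableSet_singleton 1)

variable [IsProbabilityMeasure μ]

lemma IsBernoulliSampling.integrable_exp (hδ : IsBernoulliSampling μ p δ) (α : PairIndex n)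
    (t : ℝ) : Integrable (fun x => Real.exp (t * δ α x)) μ :=
  ((integrable_const 1).add
    (((integrable_const 1).indicator (hδ.measurableSet α)).const_mul _)).congr
    (hδ.exp_mul_ae_eq α t).symm

lemma IsBernoulliSampling.mgf_eq (hδ : IsBernoulliSampling μ p δ) (α : PairIndex n) (t : ℝ) :
    mgf (δ α) μ t = 1 + (Real.exp t - 1) * p := by
  rw [mgf, integral_congr_ae (hδ.exp_mul_ae_eq α t), integral_add (integrable_const 1)
    (((integrable_const 1).indicator (hδ.measurableSet α)).const_mul _), integral_const_mul,
    integral_indicator_const _ (hδ.measurableSet α), hδ.prob_one α]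
  simp

/-- Combines `exp t - 1 ≤ t + t ^ 2` on `[0, 1]` with `1 + y ≤ exp y`. -/
lemma IsBernoulliSampling.mgf_le (hδ : IsBernoulliSampling μ p δ) (hp : 0 ≤ p) (α : PairIndex n)
    {t : ℝ} (h0 : 0 ≤ t) (h1 : t ≤ 1) : mgf (δ α) μ t ≤ Real.exp (p * (t + t ^ 2)) := by
  have h := (abs_le.1 (Real.abs_exp_sub_one_sub_id_le (abs_le.2 ⟨by linarith, h1⟩))).2
  rw [hδ.mgf_eq]
  nlinarith [Real.add_one_le_exp (p * (t + t ^ 2))]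

/-- Chernoff bound for the number of sampled pairs in a given set of pairs. -/
lemma IsBernoulliSampling.measureReal_sum_ge_le (hδ : IsBernoulliSampling μ p δ) (hp : 0 ≤ p)
    (T : Finset (PairIndex n)) {t : ℝ} (h0 : 0 ≤ t) (h1 : t ≤ 1) (ε : ℝ) :
    μ.real {x | p * T.card + ε ≤ ∑ α ∈ T, δ α x} ≤
      Real.exp (T.card * (p * t ^ 2) - t * ε) := by
  have hint : Integrable (fun x => Real.exp (t * (∑ α ∈ T, δ α) x)) μ :=
    hδ.indep.integrable_exp_mul_sum hδ.measurable fun α _ => hδ.integrable_exp α t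
  have h := measure_ge_le_exp_mul_mgf (p * T.card + ε) h0 hint
  rw [hδ.indep.mgf_sum hδ.measurable] at h
  simp only [Finset.sum_apply] at h
  calc _ ≤ _ := h
    _ ≤ Real.exp (-t * (p * T.card + ε)) * ∏ _α ∈ T, Real.exp (p * (t + t ^ 2)) := by
        gcongr with α _
        · exact fun _ _ => mgf_nonneg
        · exact hδ.mgf_le hp α h0 h1
    _ = _ := by
        rw [Finset.prod_const, ← Real.exp_nat_mul, ← Real.exp_add]
        ring_nf

lemma IsBernoulliSampling.measureReal_sum_ge_le_pow (hδ : IsBernoulliSampling μ p δ) (hp : 0 < p)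
    (hn : 0 < n) {K : ℝ} (hK0 : 0 ≤ K) (hK : K ≤ 2 * (n * p)) (T : Finset (PairIndex n)) (s : ℕ)
    (hT : T.card ≤ s * n) :
    μ.real {x | p * T.card + K * s ≤ ∑ α ∈ T, δ α x} ≤
      Real.exp (-(K ^ 2 / (4 * (n * p)))) ^ s := by
  have hn' : (0 : ℝ) < n := by exact_mod_cast hn
  have hT' : (T.card : ℝ) ≤ s * n := by exact_mod_cast hT
  -- This `t` minimizes `n p t ^ 2 - t K`; the assumption on `K` says exactly that `t ≤ 1`.
  refine (hδ.measureReal_sum_ge_le hp.le T (t := K / (2 * (n * p))) (by positivity)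
    ((div_le_one (by positivity)).2 hK) (K * s)).trans ?_
  rw [← Real.exp_nat_mul, Real.exp_le_exp]
  calc _ ≤ s * n * (p * (K / (2 * (n * p))) ^ 2) - K / (2 * (n * p)) * (K * s) := by gcongr
    _ = _ := by field_simp; ring

/-- With high probability no degree and no number of edges within a set of points is much larger
than its mean. -/
lemma IsBernoulliSampling.regular_of_le (hδ : IsBernoulliSampling μ p δ) (hp : 0 < p)
    (hn : 0 < n) {K : ℝ} (hK0 : 0 ≤ K) (hK : K ≤ 2 * (n * p)) :
    1 - (n * Real.exp (-(K ^ 2 / (4 * (n * p)))) +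
        ((Real.exp (-(K ^ 2 / (4 * (n * p)))) + 1) ^ n - 1)) ≤
      μ.real {x | (∀ α, δ α x = 0 ∨ δ α x = 1) ∧
        (∀ i, ∑ α ∈ incidentPairs i, δ α x ≤ n * p + K) ∧
        ∀ S : Finset (Fin n),
          ∑ α ∈ pairsWithin S, δ α x ≤ p * (pairsWithin S).card + K * S.card} := by
  set q := Real.exp (-(K ^ 2 / (4 * (n * p))))
  set G := {x | (∀ α, δ α x = 0 ∨ δ α x = 1) ∧
        (∀ i, ∑ α ∈ incidentPairs i, δ α x ≤ n * p + K) ∧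
        ∀ S : Finset (Fin n),
          ∑ α ∈ pairsWithin S, δ α x ≤ p * (pairsWithin S).card + K * S.card}
  set A : Set Ω := {x | ∀ α, δ α x = 0 ∨ δ α x = 1}
  set B : Fin n → Set Ω := fun i =>
    {x | p * (incidentPairs i).card + K * (1 : ℕ) ≤ ∑ α ∈ incidentPairs i, δ α x}
  set D : Finset (Fin n) → Set Ω := fun S =>
    {x | p * (pairsWithin S).card + K * S.card ≤ ∑ α ∈ pairsWithin S, δ α x}
  -- The event `D ∅` is the whole space, but the bound required for `S = ∅` is trivial.
  set 𝒮 : Finset (Finset (Fin n)) := Finset.univ.erase ∅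
  have hcover : Set.univ ⊆ G ∪ (Aᶜ ∪ ((⋃ i ∈ Finset.univ, B i) ∪ ⋃ S ∈ 𝒮, D S)) := by
    intro x _
    by_contra hx
    simp only [Set.mem_union, Set.mem_compl_iff, Set.mem_iUnion, not_or, not_not, not_exists] at hx
    obtain ⟨hxG, hxA, hxB, hxD⟩ := hx
    refine hxG ⟨hxA, fun i => ?_, fun S => ?_⟩
    · have h : ∑ α ∈ incidentPairs i, δ α x < p * (incidentPairs i).card + K * (1 : ℕ) :=
        not_le.1 (hxB i (Finset.mem_univ i))
      have hc : ((incidentPairs i).card : ℝ) ≤ n := by exact_mod_cast card_incidentPairs_le i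
      have := mul_le_mul_of_nonneg_left hc hp.le
      push_cast at h
      linarith
    · rcases S.eq_empty_or_nonempty with rfl | hS
      · have : pairsWithin (∅ : Finset (Fin n)) = ∅ := by simp [pairsWithin]
        simp [this]
      · exact (not_le.1 (hxD S (by simp [𝒮, hS.ne_empty]))).le
  have hA : μ.real Aᶜ = 0 := by
    have : ∀ᵐ x ∂μ, x ∈ A := ae_all_iff.2 hδ.zero_or_one
    rw [measureReal_def, ae_iff.1 this |> fun h => (h : μ Aᶜ = 0)]
    simp
  have hB : μ.real (⋃ i ∈ Finset.univ, B i) ≤ n * q := by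
    refine (measureReal_biUnion_finset_le _ _).trans ?_
    calc _ ≤ ∑ _i : Fin n, q ^ 1 := Finset.sum_le_sum fun i _ =>
          hδ.measureReal_sum_ge_le_pow hp hn hK0 hK _ 1 (by simpa using card_incidentPairs_le i)
      _ = _ := by simp
  have hD : μ.real (⋃ S ∈ 𝒮, D S) ≤ (q + 1) ^ n - 1 := by
    refine (measureReal_biUnion_finset_le _ _).trans ?_
    calc _ ≤ ∑ S ∈ 𝒮, q ^ S.card := Finset.sum_le_sum fun S _ =>
          hδ.measureReal_sum_ge_le_pow hp hn hK0 hK _ _ (card_pairsWithin_le S)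
      _ = _ := by
          -- Binomial theorem over subsets; the empty set accounts for the `-1`.
          rw [← Fin.sum_pow_mul_eq_add_pow, ← Finset.add_sum_erase _ _ (Finset.mem_univ ∅)]
          simp [𝒮]
  have h1 : (1 : ℝ) ≤ μ.real (G ∪ (Aᶜ ∪ ((⋃ i ∈ Finset.univ, B i) ∪ ⋃ S ∈ 𝒮, D S))) := by
    rw [← probReal_univ (μ := μ)]
    exact measureReal_mono hcover
  have h2 := measureReal_union_le (μ := μ) G (Aᶜ ∪ ((⋃ i ∈ Finset.univ, B i) ∪ ⋃ S ∈ 𝒮, D S))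
  have h3 := measureReal_union_le (μ := μ) Aᶜ ((⋃ i ∈ Finset.univ, B i) ∪ ⋃ S ∈ 𝒮, D S)
  have h4 := measureReal_union_le (μ := μ) (⋃ i ∈ Finset.univ, B i) (⋃ S ∈ 𝒮, D S)
  linarith

end BernoulliSampling

/-! ### Choice of constants and conclusion -/

/-- With `x = n ^ (-3β)`, the left side is at most `n x + (exp (n x) - 1) ≤ 3 n x`, while `n x = n ^
(1 - β) * n ^ (-2β)` is at most a quarter of the right side. -/
lemma one_add_rpow_pow_sub_one_le {n : ℕ} (hn : 2 ≤ n) {β : ℝ} (hβ : 1 < β) :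
    n * (n : ℝ) ^ (-(3 * β)) + (((n : ℝ) ^ (-(3 * β)) + 1) ^ n - 1) ≤ (n : ℝ) ^ (1 - β) := by
  have hn' : (2 : ℝ) ≤ n := by exact_mod_cast hn
  have hpos : (0 : ℝ) < n := by linarith
  set x := (n : ℝ) ^ (-(3 * β))
  have hx : 0 ≤ x := by positivity
  have hfac : n * x ≤ (n : ℝ) ^ (1 - β) * (1 / 4) := by
    have e : n * x = (n : ℝ) ^ (1 - β) * (n : ℝ) ^ (-(2 * β)) := by
      rw [← Real.rpow_add hpos]
      nth_rewrite 1 [← Real.rpow_one (n : ℝ)]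
      rw [← Real.rpow_add hpos]
      ring_nf
    rw [e]
    gcongr
    calc (n : ℝ) ^ (-(2 * β)) ≤ (n : ℝ) ^ (-2 : ℝ) :=
          Real.rpow_le_rpow_of_exponent_le (by linarith) (by linarith)
      _ ≤ (2 : ℝ) ^ (-2 : ℝ) := Real.rpow_le_rpow_of_nonpos (by norm_num) hn' (by norm_num)
      _ = 1 / 4 := by
        rw [Real.rpow_neg (by norm_num)]; norm_num
  have hle : (n : ℝ) ^ (1 - β) ≤ 1 :=
    Real.rpow_le_one_of_one_le_of_nonpos (by linarith) (by linarith)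
  have h1 : (x + 1) ^ n ≤ Real.exp (n * x) := by
    rw [Real.exp_nat_mul]
    exact pow_le_pow_left₀ (by positivity) (Real.add_one_le_exp x) n
  have hnx : 0 ≤ n * x := by positivity
  have h2 := (abs_le.1 (Real.abs_exp_sub_one_le (x := n * x)
    (abs_le.2 ⟨by linarith, by linarith⟩))).2
  rw [abs_of_nonneg hnx] at h2
  linarith

theorem mainTheorem6 :
    ∃ C c : ℝ, 0 < C ∧ 0 < c ∧
      ∀ (n r : ℕ) (β p : ℝ), 1 < β → C * (β * Real.log n / n) < p → p ≤ 1 →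
      ∀ (Ω : Type*) [MeasurableSpace Ω] (μ : Measure Ω) [IsProbabilityMeasure μ]
        (δ : PairIndex n → Ω → ℝ), IsBernoulliSampling μ p δ →
        1 - (n : ℝ) ^ (1 - β) ≤
          μ.real {x | ∀ Δ : Matrix (Fin n) (Fin r) ℝ,
            1 / p * ‖sensingOp (fun α => δ α x) (Δ * Δᵀ)‖ ^ 2 ≤
              ((8 * n + √(c * β * n * Real.log n / p)) * twoInftyNorm Δ ^ 2 + 8 * ‖Δ‖ ^ 2) *
                ‖Δ‖ ^ 2} := by
  -- `K ^ 2 = 12 β n p log n` gives `q = n ^ (-3β)`; then `K ≤ 2 n p` amounts to `n p ≥ 3 β log n`,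
  -- and `6912 = 24 ^ 2 * 12`.
  refine ⟨3, 6912, by norm_num, by norm_num, ?_⟩
  intro n r β p hβ hC _ Ω _ μ _ δ hδ
  obtain rfl | rfl | hn : n = 0 ∨ n = 1 ∨ 2 ≤ n := by omega
  · have : {x | ∀ Δ : Matrix (Fin 0) (Fin r) ℝ,
        1 / p * ‖sensingOp (fun α => δ α x) (Δ * Δᵀ)‖ ^ 2 ≤
          ((8 * (0 : ℕ) + √(6912 * β * (0 : ℕ) * Real.log (0 : ℕ) / p)) * twoInftyNorm Δ ^ 2 +
            8 * ‖Δ‖ ^ 2) * ‖Δ‖ ^ 2} = Set.univ := by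
      refine Set.eq_univ_of_forall fun x Δ => ?_
      rw [frobenius_norm_sq, frobenius_norm_sq]
      simp
    rw [this, probReal_univ]
    exact sub_le_self _ (by positivity)
  -- For `n = 1` the probability bound is `1 - 1 = 0`.
  · simp
  have hn' : (2 : ℝ) ≤ n := by exact_mod_cast hn
  have hpos : (0 : ℝ) < n := by linarith
  have hlog : 0 < Real.log n := Real.log_pos (by linarith)
  have hβ0 : 0 < β := by linarith
  have hp : 0 < p := lt_of_le_of_lt (by positivity) hC
  set K := √(12 * β * (n * p) * Real.log n) with hKdef
  have hK0 : 0 ≤ K := Real.sqrt_nonneg _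
  have hK2 : K ^ 2 = 12 * β * (n * p) * Real.log n := Real.sq_sqrt (by positivity)
  have hK : K ≤ 2 * (n * p) := by
    refine Real.sqrt_le_iff.2 ⟨by positivity, ?_⟩
    have : 3 * (β * Real.log n) ≤ n * p := by
      rw [← mul_div_assoc, div_lt_iff₀ hpos] at hC
      linarith
    nlinarith [mul_le_mul_of_nonneg_left this (by positivity : 0 ≤ 4 * (n * p))]
  have hq : Real.exp (-(K ^ 2 / (4 * (n * p)))) = (n : ℝ) ^ (-(3 * β)) := by
    rw [Real.rpow_def_of_pos hpos, hK2]
    congr 1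
    field_simp
    ring
  have hKc : 24 * K / p = √(6912 * β * n * Real.log n / p) := by
    rw [eq_comm, Real.sqrt_eq_iff_eq_sq (by positivity) (by positivity), div_pow, mul_pow, hK2]
    field_simp
    ring
  have hprob := hδ.regular_of_le hp (by omega : 0 < n) hK0 hK
  rw [hq] at hprob
  have htail := one_add_rpow_pow_sub_one_le hn hβ
  refine (by linarith : _ ≤ _).trans (hprob.trans (measureReal_mono ?_))
  rintro x ⟨h01, hdeg, hset⟩ Δ
  rw [← hKc]
  exact norm_sensingOp_sq_le_of_regular _ h01 hp hdeg hset Δ
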